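/- Let $(f_t)_{t\in\mathbb R}$ be a continuous flow on a compact metric space $(\mathbf M,d)$, and let $\Lambda\subset\mathbf M$ be a compact invariant set that is locally maximal with isolating neighborhood $U$; that is, $U$ is a neighborhood of $\Lambda$ and $\Lambda=\bigcap_{t\in\mathbb R}f_t(\mathrm{Cl}(U))$. Let $U_1$ be any neighborhood of $\Lambda$ contained in $U$, and let $\phi:U\to\mathbb R$ be a bounded continuous function. For $V\subset\mathbf M$ let $\mathcal O(V)$ be the collection of all pairs $(x,t)$ with $x\in V$, $t\ge 0$ and $f_s(x)\in V$ for all $s\in[0,t)$; let $\mathbb R^+=[0,\infty)$. For $t\ge0$ put $d_t(x,y)=\sup_{s\in[0,t]}d(f_sx,f_sy)$. A set $E$ is $(t,\delta)$-separated if $d_t(x,y)>\delta$ for all distinct $x,y\in E$. For a collection $\mathcal C\subset\mathcal O(U)$ and $\delta>0$, $t>0$ let $$\lambda(\mathcal C,\phi,\delta,t)=\sup\Big\{\sum_{x\in E}\exp\Big(\int_0^t\phi(f_sx)\,ds\Big): E\subset\{x:(x,t)\in\mathcal C\}\text{ is }(t,\delta)\text{-separated}\Big\},$$ $$P(\mathcal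 C,\phi)=\lim_{\delta\to0^+}\ \limsup_{t\to+\infty}\frac1t\log\lambda(\mathcal C,\phi,\delta,t)\in[-\infty,\infty]\qquad(\log 0=-\infty).$$ Let $P(\phi;\Lambda)$ be the topological pressure of $\phi|_\Lambda$ for the flow restricted to $\Lambda$, that is, the limit as $\delta\to0^+$ of $\limsup_{t\to+\infty}\frac1t\log\sup_E\sum_{x\in E}\exp(\int_0^t\phi(f_sx)\,ds)$, where $E$ ranges over the $(t,\delta)$-separated subsets of $\Lambda$. Then $$P(\mathcal O(U),\phi)=P(\mathcal O(U_1),\phi)=P(\Lambda\times\mathbb R^+,\phi)=P(\phi;\Lambda).$$ -/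

import Mathlib

open Set Filter Topology

noncomputable section

namespace FlowPressure

/-- The Bowen metric `d_t(x, y) = sup {d(f_s x, f_s y) : s ∈ [0, t]}`. -/
def bowenDist {X : Type*} [MetricSpace X] (F : Flow ℝ X) (t : ℝ) (x y : X) : ℝ :=
  ⨆ s : Set.Icc (0 : ℝ) t, dist (F s x) (F s y)

/-- A finite set is `(t, δ)`-separated if `d_t(x, y) > δ` for all distinct `x, y` in it.
On a compact space every `(t, δ)`-separated set with `δ > 0` is finite. -/
def IsSeparatedAt {X : Type*} [MetricSpace X] (F : Flow ℝ X) (t δ : ℝ) (E : Finset X) : Prop :=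
  ∀ x ∈ E, ∀ y ∈ E, x ≠ y → δ < bowenDist F t x y

/-- The Birkhoff integral `Φ₀(x, t) = ∫₀ᵗ φ(f_s x) ds`. -/
def birkhoffIntegral {X : Type*} [MetricSpace X] (F : Flow ℝ X) (φ : X → ℝ) (x : X) (t : ℝ) : ℝ :=
  ∫ s in (0 : ℝ)..t, φ (F s x)

/-- The section `(𝒞)_t = {x : (x, t) ∈ 𝒞}` of a collection of orbit segments; the pair `(x, t)`
stands for the segment `{f_s x : s ∈ [0, t)}`. -/
def sectionAt {X : Type*} (C : Set (X × ℝ)) (t : ℝ) : Set X :=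
  {x | (x, t) ∈ C}

/-- The partition function `λ(𝒞, φ, δ, t)`, with values in `[0, ∞]`: the supremum of
`∑_{x ∈ E} exp Φ₀(x, t)` over the `(t, δ)`-separated sets `E ⊆ (𝒞)_t`. -/
def partitionFunction {X : Type*} [MetricSpace X] (F : Flow ℝ X) (C : Set (X × ℝ)) (φ : X → ℝ)
    (δ t : ℝ) : ENNReal :=
  ⨆ (E : Finset X) (_ : (E : Set X) ⊆ sectionAt C t) (_ : IsSeparatedAt F t δ E),
    ∑ x ∈ E, ENNReal.ofReal (Real.exp (birkhoffIntegral F φ x t))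

/-- The pressure at scale `δ`: `P(𝒞, φ, δ) = limsup_{t → ∞} (1 / t) log λ(𝒞, φ, δ, t)`, in
`[-∞, ∞]` (with `log 0 = -∞` and `log ∞ = ∞`). -/
def pressureAtScale {X : Type*} [MetricSpace X] (F : Flow ℝ X) (C : Set (X × ℝ)) (φ : X → ℝ)
    (δ : ℝ) : EReal :=
  limsup (fun t : ℝ => ENNReal.log (partitionFunction F C φ δ t) / (t : EReal)) atTop

/-- The pressure `P(𝒞, φ) = lim_{δ → 0⁺} P(𝒞, φ, δ)`. The limit is monotone, hence a supremum;
see `tendsto_pressureAtScale`. -/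
def pressure {X : Type*} [MetricSpace X] (F : Flow ℝ X) (C : Set (X × ℝ)) (φ : X → ℝ) : EReal :=
  ⨆ (δ : ℝ) (_ : 0 < δ), pressureAtScale F C φ δ

theorem partitionFunction_anti {X : Type*} [MetricSpace X] (F : Flow ℝ X) (C : Set (X × ℝ))
    (φ : X → ℝ) (t : ℝ) {δ δ' : ℝ} (h : δ ≤ δ') :
    partitionFunction F C φ δ' t ≤ partitionFunction F C φ δ t := by
  refine iSup_mono fun E => iSup_mono fun _ => iSup_mono' fun hE => ⟨?_, le_rfl⟩
  exact fun x hx y hy hxy => lt_of_le_of_lt h (hE x hx y hy hxy)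

theorem pressureAtScale_anti {X : Type*} [MetricSpace X] (F : Flow ℝ X) (C : Set (X × ℝ))
    (φ : X → ℝ) {δ δ' : ℝ} (h : δ ≤ δ') :
    pressureAtScale F C φ δ' ≤ pressureAtScale F C φ δ := by
  refine limsup_le_limsup ?_
  filter_upwards [eventually_ge_atTop (0 : ℝ)] with t ht
  exact EReal.div_le_div_right_of_nonneg (by exact_mod_cast ht)
    (ENNReal.log_monotone (partitionFunction_anti F C φ t h))

/-- The defining limit of the pressure exists and is its value. -/
theorem tendsto_pressureAtScale {X : Type*} [MetricSpace X] (F : Flow ℝ X) (C : Set (X × ℝ))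
    (φ : X → ℝ) :
    Tendsto (pressureAtScale F C φ) (𝓝[>] 0) (𝓝 (pressure F C φ)) := by
  have hanti : AntitoneOn (pressureAtScale F C φ) (Ioi (0 : ℝ)) :=
    fun _ _ _ _ h => pressureAtScale_anti F C φ h
  have hsup : pressure F C φ = sSup (pressureAtScale F C φ '' Ioi (0 : ℝ)) := by
    rw [sSup_image]; rfl
  rw [hsup]
  exact hanti.tendsto_nhdsGT (OrderTop.bddAbove _)

/-- The topological pressure of a continuous function `ψ` for a flow on a compact metric space
`X`: `lim_{δ → 0⁺} limsup_{t → ∞} (1 / t) log sup_E ∑_{x ∈ E} exp ∫₀ᵗ ψ(f_s x) ds`, where `E`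
ranges over all `(t, δ)`-separated subsets of `X`. -/
def topologicalPressure {X : Type*} [MetricSpace X] (F : Flow ℝ X) (ψ : X → ℝ) : EReal :=
  ⨆ (δ : ℝ) (_ : 0 < δ), limsup (fun t : ℝ => ENNReal.log
    (⨆ (E : Finset X) (_ : IsSeparatedAt F t δ E),
      ∑ x ∈ E, ENNReal.ofReal (Real.exp (∫ s in (0 : ℝ)..t, ψ (F s x)))) / (t : EReal)) atTop

/-- `𝒪(U)`: the finite orbit segments `(x, t)`, with `x ∈ U` and `t ≥ 0`, contained in `U`. -/
def orbitSegments {X : Type*} [MetricSpace X] (F : Flow ℝ X) (U : Set X) : Set (X × ℝ) :=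
  {p | p.1 ∈ U ∧ 0 ≤ p.2 ∧ ∀ s ∈ Set.Ico (0 : ℝ) p.2, F s p.1 ∈ U}

/-- `U` is an isolating neighborhood of `Λ`: a (not necessarily open) neighborhood of `Λ` with
`Λ = ⋂_{t ∈ ℝ} f_t(closure U)`. The set `Λ` is locally maximal when it has one. -/
structure IsIsolatingNeighborhood {X : Type*} [MetricSpace X] (F : Flow ℝ X) (Λ U : Set X) :
    Prop where
  mem_nhdsSet : U ∈ 𝓝ˢ Λ
  eq_iInter : Λ = ⋂ t : ℝ, F t '' closure U

end FlowPressure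

end

/-!
The inclusions `Λ × ℝ⁺ ⊆ 𝒪(U₁) ⊆ 𝒪(U)` make the pressures increase in this order, and separated
subsets of `Λ` do not depend on whether the flow is restricted to `Λ`. What has to be shown is
`P(𝒪(U), φ) ≤ P(Λ × ℝ⁺, φ)`; the argument is a direct count of orbit segments, with no recourse to
invariant measures.

Let `a > b > P(Λ × ℝ⁺, φ)`. Take `δ` so small that `φ` varies by at most `a - b` at scale `2δ` near
`Λ`, and `T > 0` with `λ(Λ × ℝ⁺, φ, δ, T) ≤ exp (b T)`. A maximal `(T, δ)`-separated set `E ⊆ Λ`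
spans `Λ`, so the Bowen balls of radius `2δ` about `E` cover a neighborhood `V` of `Λ`
(`shadowed_mem_nhdsSet`). As `U` is isolating, there is an `R` such that a point whose orbit stays
in `U` for the times in `[-R, R]` lies in `V` (`IsIsolatingNeighborhood.exists_time`). A segment of
length `t` in `U` is therefore made of an initial piece of length `R`, of `n ≤ t / T` blocks of
length `T` each shadowed by a point of `E`, and of a final piece of length less than `R + T`.
Labelling a segment by the shadowing points of its blocks and by a finite amount of data for the
two ends gives a code that separates `(t, 4δ)`-separated points, and the weights of its labels add
up to at most `const · (exp (a T)) ^ n` (`HasWeightedCode.iterate`,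
`exists_partitionFunction_le`). Hence `P(𝒪(U), φ, 4δ) ≤ a`.
-/

/-! ### The Bowen metric -/

namespace FlowPressure

universe u

variable {M : Type u} [MetricSpace M]

/-- Orbits depend continuously on the initial point, uniformly on compact time intervals. -/
theorem eventually_forall_dist_lt (F : Flow ℝ M) (x : M) (t : ℝ) {δ : ℝ} (hδ : 0 < δ) :
    ∀ᶠ y in 𝓝 x, ∀ s ∈ Icc (0 : ℝ) t, dist (F s x) (F s y) < δ := by
  refine isCompact_Icc.eventually_forall_of_forall_eventually fun s _ => ?_
  have hc : Continuous fun z : M × ℝ => dist (F z.2 x) (F z.2 z.1) := by fun_prop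
  exact hc.continuousAt.eventually_lt_const (by simpa using hδ)

theorem exists_finset_bowen_cover [CompactSpace M] (F : Flow ℝ M) (t : ℝ) {δ : ℝ} (hδ : 0 < δ) :
    ∃ S : Finset M, ∀ y, ∃ x ∈ S, ∀ s ∈ Icc (0 : ℝ) t, dist (F s x) (F s y) < δ := by
  obtain ⟨S, -, hS⟩ := isCompact_univ.elim_nhds_subcover
    (fun x => {y | ∀ s ∈ Icc (0 : ℝ) t, dist (F s x) (F s y) < δ})
    (fun x _ => eventually_forall_dist_lt F x t hδ)
  refine ⟨S, fun y => ?_⟩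
  simpa using hS (mem_univ y)

theorem bowenDist_le (F : Flow ℝ M) {t δ : ℝ} (hδ : 0 ≤ δ) {x y : M}
    (h : ∀ s ∈ Icc (0 : ℝ) t, dist (F s x) (F s y) ≤ δ) : bowenDist F t x y ≤ δ :=
  Real.iSup_le (fun s => h s s.2) hδ

theorem dist_le_bowenDist (F : Flow ℝ M) {t s : ℝ} (hs : s ∈ Icc (0 : ℝ) t) (x y : M) :
    dist (F s x) (F s y) ≤ bowenDist F t x y := by
  have hb : BddAbove (range fun s : Icc (0 : ℝ) t => dist (F s x) (F s y)) := by
    have hc : Continuous fun s : ℝ => dist (F s x) (F s y) := by fun_prop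
    have := (isCompact_Icc (a := (0 : ℝ)) (b := t)).bddAbove_image hc.continuousOn
    rwa [image_eq_range] at this
  exact le_ciSup hb ⟨s, hs⟩

/-- Every subset of a compact space contains a finite `(t, δ)`-separated set which is
`(t, δ)`-spanning for it: a separated set of maximal cardinality. -/
theorem exists_isSeparatedAt_spanning [CompactSpace M] (F : Flow ℝ M) (Λ : Set M) (t : ℝ)
    {δ : ℝ} (hδ : 0 < δ) :
    ∃ E : Finset M, (E : Set M) ⊆ Λ ∧ IsSeparatedAt F t δ E ∧
      ∀ y ∈ Λ, ∃ x ∈ E, ∀ s ∈ Icc (0 : ℝ) t, dist (F s x) (F s y) ≤ δ := by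
  classical
  obtain ⟨S, hS⟩ := exists_finset_bowen_cover F t (half_pos hδ)
  choose c hcS hc using hS
  -- Each ball of radius `δ / 2` for the Bowen metric contains at most one point of a separated set.
  have hcard : ∀ E : Finset M, IsSeparatedAt F t δ E → E.card ≤ S.card := by
    refine fun E hE => Finset.card_le_card_of_injOn c (fun x _ => hcS x) fun x hx y hy hxy => ?_
    by_contra hne
    refine (hE x hx y hy hne).not_ge (bowenDist_le F hδ.le fun s hs => ?_)
    have h1 := hc x s hs
    have h2 := hc y s hs
    rw [hxy, dist_comm] at h1
    linarith [dist_triangle (F s x) (F s (c y)) (F s y)]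
  let p : ℕ → Prop := fun n =>
    ∃ E : Finset M, (E : Set M) ⊆ Λ ∧ IsSeparatedAt F t δ E ∧ E.card = n
  have hp0 : p 0 := ⟨∅, by simp, by simp [IsSeparatedAt], rfl⟩
  obtain ⟨E, hEΛ, hE, hn⟩ : p (Nat.findGreatest p S.card) :=
    Nat.findGreatest_spec (Nat.zero_le _) hp0
  refine ⟨E, hEΛ, hE, fun y hy => ?_⟩
  by_contra! hfar
  have hlt : ∀ x ∈ E, δ < bowenDist F t x y := fun x hx => by
    obtain ⟨s, hs, h⟩ := hfar x hx
    exact h.trans_le (dist_le_bowenDist F hs x y)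
  have hyE : y ∉ E := fun h => by
    obtain ⟨s, hs, h⟩ := hfar y h
    rw [dist_self] at h
    linarith
  have hsymm : ∀ x, bowenDist F t y x = bowenDist F t x y := fun x => by
    simp only [bowenDist, dist_comm]
  have hsep : IsSeparatedAt F t δ (insert y E) := by
    intro a ha b hb hab
    rcases Finset.mem_insert.1 ha with rfl | ha' <;> rcases Finset.mem_insert.1 hb with rfl | hb'
    · exact absurd rfl hab
    · rw [hsymm]; exact hlt b hb'
    · exact hlt a ha'
    · exact hE a ha' b hb' hab
  have hle := Nat.le_findGreatest (hcard _ hsep)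
    (show p (insert y E).card from ⟨_, by simp [insert_subset_iff, hy, hEΛ], hsep, rfl⟩)
  rw [Finset.card_insert_of_notMem hyE, hn] at hle
  omega

/-! ### Weighted codes -/

/-- `A` has a weighted code of scale `ε` and total weight at most `c` over the time `t`: its points
can be labelled by a finite set so that orbits with the same label stay `ε`-close on `[0, t]`, and
so that the label of `x` carries a weight dominating `exp ∫₀ᵗ φ(f_s x) ds`, where the weights of
all labels add up to at most `c`. The integrals are required to exist. -/
def HasWeightedCode (F : Flow ℝ M) (φ : M → ℝ) (ε t : ℝ) (A : Set M) (c : ENNReal) : Prop :=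
  (∀ x ∈ A, IntervalIntegrable (fun s => φ (F s x)) MeasureTheory.volume 0 t) ∧
    ∃ (ι : Type u) (_ : Fintype ι) (w : ι → ENNReal) (κ : A → ι),
      (∀ x y : A, κ x = κ y → ∀ s ∈ Icc (0 : ℝ) t, dist (F s x) (F s y) ≤ ε) ∧
      (∀ x : A, ENNReal.ofReal (Real.exp (birkhoffIntegral F φ x t)) ≤ w (κ x)) ∧
      ∑ i, w i ≤ c

namespace HasWeightedCode

variable {F : Flow ℝ M} {φ : M → ℝ} {ε t t' : ℝ} {A B : Set M} {c c' : ENNReal}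

theorem mono (h : HasWeightedCode F φ ε t A c) (hBA : B ⊆ A) (hc : c ≤ c') :
    HasWeightedCode F φ ε t B c' := by
  obtain ⟨hint, ι, _, w, κ, hκ, hw, hsum⟩ := h
  exact ⟨fun x hx => hint x (hBA hx), ι, ‹_›, w, fun x => κ ⟨x, hBA x.2⟩,
    fun x y hxy => hκ _ _ hxy, fun x => hw ⟨x, hBA x.2⟩, hsum.trans hc⟩

/-- Codes multiply under concatenation of orbit segments. -/
theorem concat (h : HasWeightedCode F φ ε t A c) (h' : HasWeightedCode F φ ε t' B c') :
    HasWeightedCode F φ ε (t + t') (A ∩ F t ⁻¹' B) (c * c') := by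
  obtain ⟨hint, ι, _, w, κ, hκ, hw, hsum⟩ := h
  obtain ⟨hint', ι', _, w', κ', hκ', hw', hsum'⟩ := h'
  have hshift : ∀ x s, φ (F s (F t x)) = φ (F (s + t) x) := fun x s => by rw [F.map_add]
  have hint2 : ∀ x, F t x ∈ B →
      IntervalIntegrable (fun s => φ (F s x)) MeasureTheory.volume t (t + t') := fun x hx => by
    have := hint' _ hx
    simp only [hshift] at this
    simpa [add_comm t'] using this.comp_sub_right t
  refine ⟨fun x hx => (hint x hx.1).trans (hint2 x hx.2), ι × ι', inferInstance,
    fun i => w i.1 * w' i.2, fun x => (κ ⟨x, x.2.1⟩, κ' ⟨F t x, x.2.2⟩), ?_, ?_, ?_⟩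
  · intro x y hxy s hs
    rw [Prod.mk.injEq] at hxy
    rcases le_total s t with hst | hst
    · exact hκ _ _ hxy.1 s ⟨hs.1, hst⟩
    · have := hκ' _ _ hxy.2 (s - t) ⟨by linarith, by linarith [hs.2]⟩
      simpa only [← F.map_add, sub_add_cancel] using this
  · intro x
    have hadd : birkhoffIntegral F φ x (t + t')
        = birkhoffIntegral F φ x t + birkhoffIntegral F φ (F t x) t' := by
      unfold birkhoffIntegral
      simp only [hshift]
      rw [intervalIntegral.integral_comp_add_right (fun s => φ (F s x)), zero_add, add_comm t',
        intervalIntegral.integral_add_adjacent_intervals (hint x x.2.1) (hint2 x x.2.2)]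
    rw [hadd, Real.exp_add, ENNReal.ofReal_mul (Real.exp_pos _).le]
    exact mul_le_mul' (hw ⟨x, x.2.1⟩) (hw' ⟨F t x, x.2.2⟩)
  · rw [Fintype.sum_prod_type, ← Finset.sum_mul_sum]
    exact mul_le_mul' hsum hsum'

theorem iterate (h : HasWeightedCode F φ ε t A c) (h' : HasWeightedCode F φ ε t' B c') (n : ℕ) :
    HasWeightedCode F φ ε (t + n * t') (A ∩ {x | ∀ k < n, F (t + k * t') x ∈ B}) (c * c' ^ n) := by
  induction n with
  | zero => simpa using h
  | succ n ih =>
    have := ih.concat h'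
    rw [show t + n * t' + t' = t + (n + 1 : ℕ) * t' by push_cast; ring, mul_assoc,
      ← pow_succ] at this
    exact this.mono (fun x hx => ⟨⟨hx.1, fun k hk => hx.2 k (by omega)⟩, hx.2 n (by omega)⟩) le_rfl

/-- The points of a separated set have distinct labels, so a code bounds the partition function. -/
theorem partitionFunction_le {C : Set (M × ℝ)} (h : HasWeightedCode F φ ε t (sectionAt C t) c)
    (hε : 0 ≤ ε) : partitionFunction F C φ ε t ≤ c := by
  classical
  obtain ⟨-, ι, _, w, κ, hκ, hw, hsum⟩ := h
  refine iSup_le fun E => iSup_le fun hE => iSup_le fun hsep => ?_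
  have hinj : Function.Injective fun x : E => κ ⟨x, hE x.2⟩ := fun x y hxy => by
    by_contra hne
    exact (hsep x x.2 y y.2 (fun h => hne (Subtype.ext h))).not_ge (bowenDist_le F hε (hκ _ _ hxy))
  rw [← Finset.sum_coe_sort]
  calc _ ≤ ∑ x : E, w (κ ⟨x, hE x.2⟩) := Finset.sum_le_sum fun x _ => hw ⟨x, hE x.2⟩
    _ = ∑ i ∈ Finset.univ.map ⟨_, hinj⟩, w i := by rw [Finset.sum_map]; rfl
    _ ≤ ∑ i, w i := Finset.sum_le_sum_of_subset (Finset.subset_univ _)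
    _ ≤ c := hsum

end HasWeightedCode

/-! ### Codes for orbit segments in the isolating neighborhood -/

section Codes

variable {F : Flow ℝ M} {φ : M → ℝ} {U Λ : Set M} {K t : ℝ} {x : M}

theorem intervalIntegrable_of_orbit_subset (hφ : ContinuousOn φ U) (hK : ∀ x ∈ U, |φ x| ≤ K)
    (ht : 0 ≤ t) (hx : ∀ s ∈ Ico (0 : ℝ) t, F s x ∈ U) :
    IntervalIntegrable (fun s => φ (F s x)) MeasureTheory.volume 0 t := by
  rw [intervalIntegrable_iff_integrableOn_Ico_of_le ht]
  have hc : ContinuousOn (fun s : ℝ => φ (F s x)) (Ico 0 t) :=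
    hφ.comp (by fun_prop : Continuous fun s : ℝ => F s x).continuousOn hx
  refine MeasureTheory.IntegrableOn.of_bound (C := K) (by simp)
    (hc.aestronglyMeasurable measurableSet_Ico) ?_
  filter_upwards [MeasureTheory.ae_restrict_mem measurableSet_Ico] with s hs
  exact hK _ (hx s hs)

/-- Segments in `U` of length at most `L` have a code whose total weight depends on `L` only. -/
theorem exists_hasWeightedCode_of_le [CompactSpace M] (F : Flow ℝ M) (hφ : ContinuousOn φ U)
    (hK : ∀ x ∈ U, |φ x| ≤ K) (hK0 : 0 ≤ K) (L : ℝ) {ε : ℝ} (hε : 0 < ε) :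
    ∃ C : ℝ, 0 ≤ C ∧ ∀ t, 0 ≤ t → t ≤ L →
      HasWeightedCode F φ ε t {x | ∀ s ∈ Ico (0 : ℝ) t, F s x ∈ U} (ENNReal.ofReal C) := by
  obtain ⟨S, hS⟩ := exists_finset_bowen_cover F L (half_pos hε)
  choose c hcS hc using hS
  refine ⟨S.card * Real.exp (K * L), by positivity, fun t ht htL =>
    ⟨fun x hx => intervalIntegrable_of_orbit_subset hφ hK ht hx, S, inferInstance,
      fun _ => ENNReal.ofReal (Real.exp (K * L)), fun x => ⟨c x, hcS x⟩, ?_, ?_, ?_⟩⟩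
  · intro x y hxy s hs
    have hs' : s ∈ Icc 0 L := ⟨hs.1, hs.2.trans htL⟩
    have h1 := hc x s hs'
    have h2 := hc y s hs'
    rw [Subtype.mk.injEq] at hxy
    rw [hxy, dist_comm] at h1
    linarith [dist_triangle (F s x) (F s (c y)) (F s y)]
  · intro x
    refine ENNReal.ofReal_le_ofReal (Real.exp_le_exp.2 ?_)
    have := intervalIntegral.integral_mono_on_of_le_Ioo (g := fun _ => K) ht
      (intervalIntegrable_of_orbit_subset hφ hK ht x.2) intervalIntegrable_const
      fun s hs => (abs_le.1 (hK _ (x.2 s ⟨hs.1.le, hs.2⟩))).2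
    rw [intervalIntegral.integral_const, sub_zero, smul_eq_mul, mul_comm] at this
    exact this.trans (mul_le_mul_of_nonneg_left htL hK0)
  · rw [Finset.sum_const, nsmul_eq_mul, ENNReal.ofReal_mul (by positivity)]
    simp

/-- Segments in `U` of length `t` that are shadowed by a finite subset `E` of the invariant set
`Λ` are coded by `E`; the variation of `φ` at the shadowing scale enters the weights. -/
theorem hasWeightedCode_of_shadowed (hφ : ContinuousOn φ U) (hK : ∀ x ∈ U, |φ x| ≤ K)
    (hinv : IsInvariant F Λ) (hΛU : Λ ⊆ U) (ht : 0 ≤ t) {δ η : ℝ}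
    (hη : ∀ x ∈ Λ, ∀ y, dist x y < δ → φ y ≤ φ x + η) {E : Finset M} (hE : (E : Set M) ⊆ Λ) :
    HasWeightedCode F φ (2 * δ) t
      ({y | ∀ s ∈ Ico (0 : ℝ) t, F s y ∈ U} ∩
        {y | ∃ x ∈ E, ∀ s ∈ Icc (0 : ℝ) t, dist (F s x) (F s y) < δ})
      (ENNReal.ofReal (Real.exp (η * t)) *
        ∑ x ∈ E, ENNReal.ofReal (Real.exp (birkhoffIntegral F φ x t))) := by
  have hsh : ∀ y : ↥({y | ∀ s ∈ Ico (0 : ℝ) t, F s y ∈ U} ∩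
      {y | ∃ x ∈ E, ∀ s ∈ Icc (0 : ℝ) t, dist (F s x) (F s y) < δ}),
      ∃ x ∈ E, ∀ s ∈ Icc (0 : ℝ) t, dist (F s x) (F s y) < δ := fun y => y.2.2
  choose c hcE hc using hsh
  refine ⟨fun y hy => intervalIntegrable_of_orbit_subset hφ hK ht hy.1, E, inferInstance,
    fun x => ENNReal.ofReal (Real.exp (η * t)) *
      ENNReal.ofReal (Real.exp (birkhoffIntegral F φ x t)),
    fun y => ⟨c y, hcE y⟩, ?_, ?_, ?_⟩
  · intro x y hxy s hs
    have h1 := hc x s hs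
    have h2 := hc y s hs
    rw [Subtype.mk.injEq] at hxy
    rw [hxy, dist_comm] at h1
    linarith [dist_triangle (F s x) (F s (c y)) (F s y)]
  · intro y
    have hx : c y ∈ Λ := hE (hcE y)
    have hxint := intervalIntegrable_of_orbit_subset hφ hK ht
      (fun s _ => hΛU (hinv s hx))
    change _ ≤ ENNReal.ofReal (Real.exp (η * t)) *
      ENNReal.ofReal (Real.exp (birkhoffIntegral F φ (c y) t))
    rw [← ENNReal.ofReal_mul (Real.exp_pos _).le, ← Real.exp_add]
    refine ENNReal.ofReal_le_ofReal (Real.exp_le_exp.2 ?_)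
    have := intervalIntegral.integral_mono_on_of_le_Ioo ht
      (intervalIntegrable_of_orbit_subset hφ hK ht y.2.1) (hxint.add intervalIntegrable_const)
      fun s hs => hη _ (hinv s hx) _ (hc y s ⟨hs.1.le, hs.2.le⟩)
    rw [intervalIntegral.integral_add hxint intervalIntegrable_const,
      intervalIntegral.integral_const, sub_zero, smul_eq_mul] at this
    unfold birkhoffIntegral
    linarith
  · rw [← Finset.mul_sum, Finset.sum_coe_sort E
      fun x => ENNReal.ofReal (Real.exp (birkhoffIntegral F φ x t))]

end Codes

/-- Points whose orbit stays in the closure of an isolating neighborhood for a long time, in the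
past and in the future, are close to the isolated set. -/
theorem IsIsolatingNeighborhood.exists_time [CompactSpace M] {F : Flow ℝ M} {Λ U V : Set M}
    (hU : IsIsolatingNeighborhood F Λ U) (hV : V ∈ 𝓝ˢ Λ) :
    ∃ R : ℝ, 0 ≤ R ∧ ∀ x, (∀ s ∈ Icc (-R) R, F s x ∈ closure U) → x ∈ V := by
  have hmem : ∀ x, (∀ s, F s x ∈ closure U) → x ∈ Λ := fun x hx => by
    rw [hU.eq_iInter]
    exact mem_iInter.2 fun s => ⟨F (-s) x, hx _, by simp [← F.map_add]⟩
  obtain ⟨u, hu⟩ := (isClosed_compl_iff.2 (isOpen_interior (s := V))).isCompact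
    |>.elim_finite_subfamily_closed (fun s : ℝ => F s ⁻¹' closure U)
      (fun s => isClosed_closure.preimage (by fun_prop)) (by
        refine eq_empty_of_forall_notMem fun x hx => hx.1 ?_
        exact subset_interior_iff_mem_nhdsSet.2 hV (hmem x (by simpa using hx.2)))
  refine ⟨∑ s ∈ u, |s|, Finset.sum_nonneg fun s _ => abs_nonneg s, fun x hx => ?_⟩
  by_contra hxV
  refine (hu ▸ notMem_empty x) ⟨fun h => hxV (interior_subset h), mem_iInter₂.2 fun s hs => ?_⟩
  exact hx s (abs_le.1 (Finset.single_le_sum (f := fun s : ℝ => |s|)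
    (fun s _ => abs_nonneg s) hs))

theorem shadowed_mem_nhdsSet {F : Flow ℝ M} {Λ : Set M} {t δ δ' : ℝ} (hδ : δ < δ') {E : Finset M}
    (hE : ∀ y ∈ Λ, ∃ x ∈ E, ∀ s ∈ Icc (0 : ℝ) t, dist (F s x) (F s y) ≤ δ) :
    {y | ∃ x ∈ E, ∀ s ∈ Icc (0 : ℝ) t, dist (F s x) (F s y) < δ'} ∈ 𝓝ˢ Λ := by
  refine mem_nhdsSet_iff_forall.2 fun z hz => ?_
  obtain ⟨x, hxE, hx⟩ := hE z hz
  filter_upwards [eventually_forall_dist_lt F z t (sub_pos.2 hδ)] with y hy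
  exact ⟨x, hxE, fun s hs => by
    linarith [hx s hs, hy s hs, dist_triangle (F s x) (F s z) (F s y)]⟩

/-- A continuous function has uniformly small variation near a compact set. -/
theorem exists_forall_dist_lt_le_add {φ : M → ℝ} {U Λ : Set M} (hΛ : IsCompact Λ)
    (hU : U ∈ 𝓝ˢ Λ) (hφ : ContinuousOn φ U) {η : ℝ} (hη : 0 < η) :
    ∃ δ > 0, ∀ x ∈ Λ, ∀ y, dist x y < δ → φ y ≤ φ x + η := by
  have hat : ∀ x ∈ Λ, ContinuousAt φ x := fun x hx =>
    hφ.continuousAt (mem_nhdsSet_iff_forall.1 hU x hx)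
  obtain ⟨δ, hδ, h⟩ := Metric.mem_uniformity_dist.1
    (hΛ.uniformContinuousAt_of_continuousAt φ hat (Metric.dist_mem_uniformity hη))
  refine ⟨δ, hδ, fun x hx y hxy => ?_⟩
  have h1 : |φ x - φ y| < η := h hxy hx
  linarith [(abs_lt.1 h1).1]

/-! ### Comparison of the pressures -/

theorem limsup_log_div_le {f : ℝ → ENNReal} {a D : ℝ}
    (h : ∀ᶠ t in atTop, f t ≤ ENNReal.ofReal (Real.exp (D + a * t))) :
    limsup (fun t : ℝ => ENNReal.log (f t) / (t : EReal)) atTop ≤ a := by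
  have hlim : Tendsto (fun t : ℝ => ((D / t + a : ℝ) : EReal)) atTop (𝓝 (a : EReal)) := by
    refine (continuous_coe_real_ereal.tendsto a).comp ?_
    simpa using (tendsto_const_nhds.div_atTop tendsto_id (a := D)).add_const a
  rw [← hlim.limsup_eq]
  refine limsup_le_limsup ?_
  filter_upwards [h, eventually_gt_atTop 0] with t ht ht0
  refine (EReal.div_le_div_right_of_nonneg (by exact_mod_cast ht0.le)
    (ENNReal.log_monotone ht)).trans ?_
  rw [ENNReal.log_ofReal_of_pos (Real.exp_pos _), Real.log_exp, ← EReal.coe_div,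
    EReal.coe_le_coe_iff, add_div, mul_div_cancel_right₀ _ ht0.ne']

theorem pressure_mono (F : Flow ℝ M) (φ : M → ℝ) {C C' : Set (M × ℝ)} (h : C ⊆ C') :
    pressure F C φ ≤ pressure F C' φ := by
  refine iSup₂_mono fun δ _ => limsup_le_limsup ?_
  filter_upwards [eventually_ge_atTop (0 : ℝ)] with t ht
  refine EReal.div_le_div_right_of_nonneg (by exact_mod_cast ht) (ENNReal.log_monotone ?_)
  exact iSup_mono fun E => iSup_mono' fun hE => ⟨fun x hx => h (hE hx), le_rfl⟩

/-- Cutting long orbit segments of `U` into blocks of length `T`, each shadowed by `E` except for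
bounded pieces at both ends, bounds the exponential growth rate of the partition function. -/
theorem exists_partitionFunction_le [CompactSpace M] {F : Flow ℝ M} {Λ U : Set M}
    (hinv : IsInvariant F Λ) (hU : IsIsolatingNeighborhood F Λ U) {φ : M → ℝ}
    (hφ : ContinuousOn φ U) {K : ℝ} (hK : ∀ x ∈ U, |φ x| ≤ K) (hK0 : 0 ≤ K) {δ η a b T : ℝ}
    (hδ : 0 < δ) (hT : 0 < T) (hη : ∀ x ∈ Λ, ∀ y, dist x y < 2 * δ → φ y ≤ φ x + η)
    (hab : η + b ≤ a)
    (hb : partitionFunction F (Λ ×ˢ Ici (0 : ℝ)) φ δ T ≤ ENNReal.ofReal (Real.exp (b * T))) :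
    ∃ D : ℝ, ∀ᶠ t in atTop, partitionFunction F (orbitSegments F U) φ (2 * (2 * δ)) t
      ≤ ENNReal.ofReal (Real.exp (D + a * t)) := by
  obtain ⟨E, hEΛ, hEsep, hEspan⟩ := exists_isSeparatedAt_spanning F Λ T hδ
  have hΛU : Λ ⊆ U := subset_of_mem_nhdsSet hU.mem_nhdsSet
  have hsum : ∑ x ∈ E, ENNReal.ofReal (Real.exp (birkhoffIntegral F φ x T))
      ≤ ENNReal.ofReal (Real.exp (b * T)) :=
    le_trans (by
      unfold partitionFunction
      refine le_iSup_of_le E (le_iSup_of_le (fun x hx => ⟨hEΛ hx, hT.le⟩) ?_)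
      exact le_iSup_of_le hEsep le_rfl) hb
  have hblock := (hasWeightedCode_of_shadowed hφ hK hinv hΛU hT.le hη hEΛ).mono
    (c' := ENNReal.ofReal (Real.exp (a * T))) subset_rfl (by
      refine (mul_le_mul_right hsum _).trans ?_
      rw [← ENNReal.ofReal_mul (Real.exp_pos _).le, ← Real.exp_add, ← add_mul]
      gcongr)
  obtain ⟨R, hR0, hR⟩ := hU.exists_time (shadowed_mem_nhdsSet (by linarith : δ < 2 * δ) hEspan)
  obtain ⟨C, hC0, hC⟩ :=
    exists_hasWeightedCode_of_le F hφ hK hK0 (R + T) (by linarith : 0 < 2 * (2 * δ))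
  refine ⟨C * C + |a| * (2 * R + T), ?_⟩
  filter_upwards [eventually_ge_atTop (2 * R)] with t ht
  set n := ⌊(t - 2 * R) / T⌋₊
  have hn : n * T ≤ t - 2 * R := (le_div_iff₀ hT).1 (Nat.floor_le (by
    have : 0 ≤ t - 2 * R := by linarith
    positivity))
  have hn' : t - 2 * R < (n + 1) * T := (div_lt_iff₀ hT).1 (Nat.lt_floor_add_one _)
  set r := t - R - n * T
  have hcode := ((hC R hR0 (by linarith)).iterate hblock n).concat
    (hC r (by linarith) (by linarith))
  rw [show R + n * T + r = t by ring] at hcode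
  refine (HasWeightedCode.partitionFunction_le (hcode.mono ?_ le_rfl) (by linarith)).trans ?_
  · rintro x ⟨-, -, hx⟩
    have hnT : 0 ≤ n * T := by positivity
    have block : ∀ k < n, 0 ≤ k * T ∧ k * T + T ≤ n * T := fun k hk => by
      have : (k : ℝ) + 1 ≤ n := by exact_mod_cast hk
      exact ⟨by positivity, by nlinarith⟩
    refine ⟨⟨fun s hs => hx s ⟨hs.1, by linarith [hs.2]⟩, fun k hk => ⟨fun s hs => ?_, ?_⟩⟩,
      fun s hs => ?_⟩
    · rw [← F.map_add]
      obtain ⟨hk0, hkn⟩ := block k hk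
      exact hx _ ⟨by linarith [hs.1], by linarith [hs.2]⟩
    · -- The block starts at distance at least `R` from both ends of the segment.
      refine hR _ fun s hs => subset_closure ?_
      rw [← F.map_add]
      obtain ⟨hk0, hkn⟩ := block k hk
      exact hx _ ⟨by linarith [hs.1], by linarith [hs.2]⟩
    · rw [← F.map_add]
      exact hx _ ⟨by linarith [hs.1], by linarith [hs.2]⟩
  · rw [← ENNReal.ofReal_pow (Real.exp_pos _).le, ← ENNReal.ofReal_mul hC0,
      ← ENNReal.ofReal_mul (by positivity), ← Real.exp_nat_mul]
    refine ENNReal.ofReal_le_ofReal ?_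
    have hexp : n * (a * T) ≤ |a| * (2 * R + T) + a * t := by
      have h1 : a * (n * T - t) ≤ |a| * |n * T - t| := (le_abs_self _).trans (abs_mul _ _).le
      have h2 : |n * T - t| ≤ 2 * R + T := abs_le.2 ⟨by linarith, by linarith⟩
      linarith [mul_le_mul_of_nonneg_left h2 (abs_nonneg a)]
    calc C * Real.exp (n * (a * T)) * C = (C * C) * Real.exp (n * (a * T)) := by ring
      _ ≤ Real.exp (C * C) * Real.exp (|a| * (2 * R + T) + a * t) := by
        gcongr
        linarith [Real.add_one_le_exp (C * C)]
      _ = _ := by rw [← Real.exp_add, add_assoc]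

theorem pressure_orbitSegments_le [CompactSpace M] {F : Flow ℝ M} {Λ U : Set M}
    (hΛ : IsCompact Λ) (hinv : IsInvariant F Λ) (hU : IsIsolatingNeighborhood F Λ U) {φ : M → ℝ}
    (hφ : ContinuousOn φ U) (hφb : ∃ K : ℝ, ∀ x ∈ U, |φ x| ≤ K) :
    pressure F (orbitSegments F U) φ ≤ pressure F (Λ ×ˢ Ici (0 : ℝ)) φ := by
  obtain ⟨K, hK⟩ := hφb
  refine EReal.le_of_forall_lt_iff_le.1 fun a ha => iSup₂_le fun δ₀ hδ₀ => ?_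
  obtain ⟨b, hb, hba⟩ := EReal.lt_iff_exists_real_btwn.1 ha
  obtain ⟨δ₁, hδ₁, hη⟩ := exists_forall_dist_lt_le_add hΛ hU.mem_nhdsSet hφ
    (sub_pos.2 (EReal.coe_lt_coe_iff.1 hba))
  obtain ⟨δ, hδ, hδδ⟩ : ∃ δ > 0, 2 * δ ≤ δ₁ ∧ 2 * (2 * δ) ≤ δ₀ :=
    ⟨min (δ₁ / 2) (δ₀ / 4), lt_min (by linarith) (by linarith),
      by linarith [min_le_left (δ₁ / 2) (δ₀ / 4)], by linarith [min_le_right (δ₁ / 2) (δ₀ / 4)]⟩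
  have hscale : pressureAtScale F (Λ ×ˢ Ici (0 : ℝ)) φ δ < b :=
    (le_iSup₂ (f := fun δ (_ : 0 < δ) => pressureAtScale F _ φ δ) δ hδ).trans_lt hb
  obtain ⟨T, hT, hT0⟩ := ((eventually_lt_of_limsup_lt hscale).and (eventually_gt_atTop 0)).exists
  have hle : partitionFunction F (Λ ×ˢ Ici (0 : ℝ)) φ δ T ≤ ENNReal.ofReal (Real.exp (b * T)) := by
    rw [EReal.div_lt_iff (by exact_mod_cast hT0) (EReal.coe_ne_top T)] at hT
    rw [← ENNReal.log_le_log_iff, ENNReal.log_ofReal_of_pos (Real.exp_pos _), Real.log_exp]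
    exact hT.le
  obtain ⟨D, hD⟩ := exists_partitionFunction_le hinv hU hφ
    (fun x hx => (hK x hx).trans (le_abs_self K)) (abs_nonneg K) hδ hT0
    (fun x hx y hxy => hη x hx y (hxy.trans_le hδδ.1)) (by linarith : a - b + b ≤ a) hle
  exact (pressureAtScale_anti F _ φ hδδ.2).trans (limsup_log_div_le hD)

/-- Separated subsets of `Λ` are the same for the flow on `M` and for its restriction to `Λ`. -/
theorem pressure_prod_Ici_eq_topologicalPressure (F : Flow ℝ M) {Λ : Set M}
    (hinv : IsInvariant F Λ) (φ : M → ℝ) :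
    pressure F (Λ ×ˢ Ici (0 : ℝ)) φ
      = topologicalPressure (F.restrict hinv) (fun x : Λ => φ x) := by
  classical
  have hdist : ∀ t (x y : Λ), bowenDist (F.restrict hinv) t x y = bowenDist F t x y :=
    fun _ _ _ => rfl
  refine iSup_congr fun δ => iSup_congr fun _ => limsup_congr ?_
  filter_upwards [eventually_ge_atTop (0 : ℝ)] with t ht
  congr 2
  apply le_antisymm
  · refine iSup_le fun E => iSup_le fun hE => iSup_le fun hsep => ?_
    have hEΛ : ∀ x ∈ E, x ∈ Λ := fun x hx => (hE hx).1
    refine le_iSup_of_le (E.subtype (· ∈ Λ)) (le_iSup_of_le ?_ ?_)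
    · intro x hx y hy hxy
      rw [hdist]
      exact hsep x (Finset.mem_subtype.1 hx) y (Finset.mem_subtype.1 hy)
        fun h => hxy (Subtype.ext h)
    · exact (Finset.sum_subtype_of_mem
        (fun x => ENNReal.ofReal (Real.exp (birkhoffIntegral F φ x t))) hEΛ).ge
  · refine iSup_le fun E => iSup_le fun hsep => ?_
    refine le_iSup_of_le (E.map (Function.Embedding.subtype _)) (le_iSup_of_le ?_
      (le_iSup_of_le ?_ ?_))
    · intro x hx
      obtain ⟨y, -, rfl⟩ := Finset.mem_map.1 hx
      exact ⟨y.2, ht⟩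
    · intro x hx y hy hxy
      obtain ⟨x, hx', rfl⟩ := Finset.mem_map.1 hx
      obtain ⟨y, hy', rfl⟩ := Finset.mem_map.1 hy
      exact hsep x hx' y hy' fun h => hxy (congrArg _ h)
    · rw [Finset.sum_map]
      rfl

end FlowPressure

theorem mainTheorem4 {M : Type*} [MetricSpace M] [CompactSpace M] (F : Flow ℝ M)
    (Λ U U₁ : Set M) (hΛ : IsCompact Λ) (hinv : IsInvariant F Λ)
    (hU : FlowPressure.IsIsolatingNeighborhood F Λ U)
    (hU₁ : U₁ ∈ 𝓝ˢ Λ) (hU₁U : U₁ ⊆ U)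
    (φ : M → ℝ) (hφ : ContinuousOn φ U) (hφb : ∃ K : ℝ, ∀ x ∈ U, |φ x| ≤ K) :
    FlowPressure.pressure F (FlowPressure.orbitSegments F U) φ
        = FlowPressure.pressure F (FlowPressure.orbitSegments F U₁) φ ∧
      FlowPressure.pressure F (FlowPressure.orbitSegments F U₁) φ
        = FlowPressure.pressure F (Λ ×ˢ Set.Ici (0 : ℝ)) φ ∧
      FlowPressure.pressure F (Λ ×ˢ Set.Ici (0 : ℝ)) φ
        = FlowPressure.topologicalPressure (F.restrict hinv) (fun x : Λ => φ x) := by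
  have h₁ : FlowPressure.pressure F (Λ ×ˢ Set.Ici (0 : ℝ)) φ
      ≤ FlowPressure.pressure F (FlowPressure.orbitSegments F U₁) φ :=
    FlowPressure.pressure_mono F φ fun p hp =>
      ⟨subset_of_mem_nhdsSet hU₁ hp.1, hp.2,
        fun s _ => subset_of_mem_nhdsSet hU₁ (hinv s hp.1)⟩
  have h₂ : FlowPressure.pressure F (FlowPressure.orbitSegments F U₁) φ
      ≤ FlowPressure.pressure F (FlowPressure.orbitSegments F U) φ :=
    FlowPressure.pressure_mono F φ fun p hp =>
      ⟨hU₁U hp.1, hp.2.1, fun s hs => hU₁U (hp.2.2 s hs)⟩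
  have h₃ := FlowPressure.pressure_orbitSegments_le hΛ hinv hU hφ hφb
  exact ⟨(h₃.trans h₁).antisymm h₂, (h₂.trans h₃).antisymm h₁,
    FlowPressure.pressure_prod_Ici_eq_topologicalPressure F hinv φ⟩
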